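/- All graphs are finite. A directed acyclic graph (DAG) encodes the conditional independencies given by d-separation, and two DAGs on the same vertex set are Markov equivalent if they encode the same conditional independencies. The essential graph of a DAG $D$ is the graph with the same skeleton as $D$ in which an edge is directed if and only if it has the same orientation in every DAG that is Markov equivalent to $D$; all its other edges are undirected. A graph $C$ represents the Markov equivalence class of all DAGs whose essential graph is $C$, and $\mathrm{Size}(C)$ denotes the size of this class. For an undirected graph $K$ and a vertex $v$ of $K$, a $v$-rooted DAG of $K$ is a DAG in the Markov equivalence class represented by $K$ in which every edge at $v$ is directed out of $v$. The $v$-rooted essential graph $K^{(v)}$ has the same skeleton as $K$, and an edge is directed in $K^{(v)}$ if and only if it has the same orientation in every $v$-rooted DAG of $K$; it represents the set of $v$-rooted DAGs of $K$, and $\mathrm{Size}(K^{(v)})$ denotes the size of this set. Write $K_{N_v}$ for the subgraph of $K$ induced on the set of neighbours of $v$. For an undirected graph $K$ and an integer $m\ge 0$, let $K^{m+}$ be the graph obtained from $K$ by adding $m$ new vertices, each adjacent to all other vertices (old and new), and let $f(K,m)=\mathrm{Size}(K^{m+})$. Theorem. Let $K$ be an undirected chordal graph (not necessarily connected) on the vertex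 set $V$. Then $f(K,0)=\mathrm{Size}(K)$, $\mathrm{Size}(K_{N_v})>0$ for every $v\in V$, and for every integer $m>0$, $$f(K,m)=m\cdot f(K,m-1)+\sum_{v\in V} f(K_{N_v},m)\,\frac{\mathrm{Size}(K^{(v)})}{\mathrm{Size}(K_{N_v})}.$$ -/

import Mathlib

namespace MarkovCount

/-- A directed acyclic graph on `V`: a digraph without directed cycles
(no vertex can be reached from itself along a nonempty sequence of arrows). -/
structure DAG (V : Type*) extends Digraph V where
  acyclic : ∀ v, ¬ Relation.TransGen Adj v v

/-- A graph whose edges are directed (`Arrow a b`, meaning `a → b`) or undirected (`Line a b`),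
with at most one edge between two vertices and no loops. -/
@[ext]
structure MixedGraph (V : Type*) where
  Arrow : V → V → Prop
  Line : V → V → Prop
  arrow_asymm : ∀ a b, Arrow a b → ¬ Arrow b a
  line_symm : ∀ a b, Line a b → Line b a
  line_irrefl : ∀ a, ¬ Line a a
  arrow_not_line : ∀ a b, Arrow a b → ¬ Line a b

/-- An undirected graph, seen as a graph all of whose edges are undirected. -/
def MixedGraph.ofUndirected {V : Type*} (K : SimpleGraph V) : MixedGraph V where
  Arrow _ _ := False
  Line := K.Adj
  arrow_asymm _ _ h := h.elim
  line_symm _ _ h := h.symm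
  line_irrefl _ h := h.ne rfl
  arrow_not_line _ _ h := h.elim

namespace DAG

variable {V : Type*}

theorem asymm (D : DAG V) {a b : V} (h : D.Adj a b) : ¬ D.Adj b a :=
  fun h' => D.acyclic a (.tail (.single h) h')

theorem irrefl (D : DAG V) (a : V) : ¬ D.Adj a a :=
  fun h => D.acyclic a (.single h)

/-- The undirected graph with the same vertices and edges, regardless of their directions. -/
def skeleton (D : DAG V) : SimpleGraph V where
  Adj a b := D.Adj a b ∨ D.Adj b a
  symm := ⟨fun _ _ h => Or.symm h⟩
  loopless := ⟨fun a h => h.elim (D.irrefl a) (D.irrefl a)⟩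

/-- The `(i + 1)`-st vertex of `p` is a collider on `p`: both adjacent edges of `p` point to it. -/
def IsCollider (D : DAG V) {a b : V} (p : D.skeleton.Walk a b) (i : ℕ) : Prop :=
  D.Adj (p.getVert i) (p.getVert (i + 1)) ∧ D.Adj (p.getVert (i + 2)) (p.getVert (i + 1))

/-- `p` is active (d-connecting) given `Z`: every inner vertex of `p` that is a collider on `p` is
in `Z` or has a descendant in `Z`, and every other inner vertex of `p` is outside `Z`. -/
def IsActive (D : DAG V) {a b : V} (p : D.skeleton.Walk a b) (Z : Set V) : Prop :=
  ∀ i, i + 2 ≤ p.length →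
    (D.IsCollider p i → ∃ z ∈ Z, Relation.ReflTransGen D.Adj (p.getVert (i + 1)) z) ∧
    (¬ D.IsCollider p i → p.getVert (i + 1) ∉ Z)

/-- `Z` d-separates `A` from `B`: no path between `A` and `B` is active given `Z`. -/
def DSep (D : DAG V) (A B Z : Set V) : Prop :=
  ∀ a ∈ A, ∀ b ∈ B, ∀ p : D.skeleton.Walk a b, p.IsPath → ¬ D.IsActive p Z

/-- Two DAGs are Markov equivalent if they encode the same conditional independencies
`A ⫫ B | Z` (for pairwise disjoint sets of vertices), as read off by d-separation. -/
def MarkovEquiv (D D' : DAG V) : Prop :=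
  ∀ A B Z : Set V, Disjoint A B → Disjoint A Z → Disjoint B Z → (D.DSep A B Z ↔ D'.DSep A B Z)

theorem MarkovEquiv.refl (D : DAG V) : D.MarkovEquiv D := fun _ _ _ _ _ _ => Iff.rfl

/-- The essential graph of (the Markov equivalence class of) `D`: it has the same skeleton as `D`,
and an edge is directed if and only if it has the same orientation in every DAG that is Markov
equivalent to `D`. -/
def essentialGraph (D : DAG V) : MixedGraph V where
  Arrow a b := ∀ D' : DAG V, D.MarkovEquiv D' → D'.Adj a b
  Line a b := D.skeleton.Adj a b ∧
    (¬ ∀ D' : DAG V, D.MarkovEquiv D' → D'.Adj a b) ∧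
    (¬ ∀ D' : DAG V, D.MarkovEquiv D' → D'.Adj b a)
  arrow_asymm _ _ h h' := D.asymm (h D (.refl D)) (h' D (.refl D))
  line_symm _ _ h := ⟨h.1.symm, h.2.2, h.2.1⟩
  line_irrefl _ h := h.1.ne rfl
  arrow_not_line _ _ h h' := h'.2.1 h

/-- `v` is a root of `D`: all edges at `v` are directed out of `v`. -/
def IsRoot (D : DAG V) (v : V) : Prop := ∀ u, ¬ D.Adj u v

end DAG

/-- The Markov equivalence class represented by the graph `C`: all DAGs with essential graph `C`. -/
def markovClass {V : Type*} (C : MixedGraph V) : Set (DAG V) := {D | D.essentialGraph = C}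

/-- The size of the Markov equivalence class represented by `C`. -/
noncomputable def Size {V : Type*} (C : MixedGraph V) : ℕ := (markovClass C).ncard

/-- The `v`-rooted sub-class of an undirected graph `U`: the `v`-rooted DAGs in the Markov
equivalence class represented by `U`. -/
def rootedSubclass {V : Type*} (U : SimpleGraph V) (v : V) : Set (DAG V) :=
  {D | D ∈ markovClass (MixedGraph.ofUndirected U) ∧ D.IsRoot v}

/-- There are `v`-rooted DAGs of `U`, and all of them contain `a → b`, an orientation of an edge
of `U`. -/
def RootedArrow {V : Type*} (U : SimpleGraph V) (v a b : V) : Prop :=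
  U.Adj a b ∧ (rootedSubclass U v).Nonempty ∧ ∀ D ∈ rootedSubclass U v, D.Adj a b

/-- The `v`-rooted essential graph `U⁽ᵛ⁾`: it has the same skeleton as `U`, and an edge is directed
if and only if it has the same orientation in every `v`-rooted DAG of `U`. -/
def rootedEssentialGraph {V : Type*} (U : SimpleGraph V) (v : V) : MixedGraph V where
  Arrow a b := RootedArrow U v a b
  Line a b := U.Adj a b ∧ ¬ RootedArrow U v a b ∧ ¬ RootedArrow U v b a
  arrow_asymm _ _ h h' :=
    let ⟨D, hD⟩ := h.2.1
    D.asymm (h.2.2 D hD) (h'.2.2 D hD)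
  line_symm _ _ h := ⟨h.1.symm, h.2.2, h.2.1⟩
  line_irrefl _ h := h.1.ne rfl
  arrow_not_line _ _ h h' := h'.2.1 h

/-- The size of the rooted sub-class represented by the graph `R` with root `v`. The undirected
graph `U` with `U⁽ᵛ⁾ = R`, if there is one, is unique, being the skeleton of `R`. -/
noncomputable def RootedSize {V : Type*} (R : MixedGraph V) (v : V) : ℕ :=
  {D : DAG V | ∃ U : SimpleGraph V, rootedEssentialGraph U v = R ∧ D ∈ rootedSubclass U v}.ncard

/-- Every cycle with four or more vertices has a chord, that is an edge joining two vertices of the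
cycle that are not adjacent on it. -/
def IsChordal {V : Type*} (K : SimpleGraph V) : Prop :=
  ∀ (v : V) (c : K.Walk v v), c.IsCycle → 4 ≤ c.length →
    ∃ a ∈ c.support, ∃ b ∈ c.support, K.Adj a b ∧ s(a, b) ∉ c.edges

/-- The extended graph `K^{m+}`: `m` new vertices are added to `K`, each of which is adjacent to
all other vertices, old and new. -/
def extended {V : Type*} (K : SimpleGraph V) (m : ℕ) : SimpleGraph (V ⊕ Fin m) :=
  (K ⊕g (⊤ : SimpleGraph (Fin m))) ⊔ completeBipartiteGraph V (Fin m)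

/-- `f(K, m)`, the size of the extended graph `K^{m+}`. -/
noncomputable def f {V : Type*} (K : SimpleGraph V) (m : ℕ) : ℕ :=
  Size (MixedGraph.ofUndirected (extended K m))

/-- `K_{N_v}`, the subgraph of `K` induced on the set of neighbours of `v`. -/
abbrev nbrGraph {V : Type*} (K : SimpleGraph V) (v : V) : SimpleGraph (K.neighborSet v) :=
  K.induce (K.neighborSet v)

end MarkovCount

namespace MarkovCount

/-! Counting a class reduces to counting acyclic moral orientations (AMOs). If the essential graph
of a DAG has no arrows, the DAG is moral, since Markov equivalence preserves unshielded colliders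
(`MarkovEquiv.collider`). Conversely, d-separation in a moral DAG is plain separation in the
skeleton (`IsMoral.dsep_iff`), so moral DAGs with equal skeletons are equivalent. By Dirac's
argument a chordal graph has an AMO rooted at any given vertex, so every edge can be reversed and
none is directed (`Rootable.mem_markovClass_iff`).

For `m > 0` a new vertex dominates `K^{m+}`, so each AMO has exactly one root (`ncard_amo_eq_sum`).
A new vertex as root can be deleted, leaving an AMO of `K^{(m-1)+}`. With an old vertex `v` as root,
an AMO is an independent choice of an AMO on the neighbours of `v` and an admissible orientation on
the far vertices (`bijOn_glue`). The second factor is the same for `K` and `K^{m+}`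
(`isOuter_splitOld_iff`); for `K` it equals the quotient `Size(K^{(v)}) / Size(K_{N_v})`. -/

variable {V : Type*}

/-! ### Markov equivalence and moral DAGs -/

/-- The edges of `G` that avoid `Z`. -/
def avoiding (G : SimpleGraph V) (Z : Set V) : SimpleGraph V where
  Adj a b := G.Adj a b ∧ a ∉ Z ∧ b ∉ Z
  symm := ⟨fun _ _ h => ⟨h.1.symm, h.2.2, h.2.1⟩⟩
  loopless := ⟨fun _ h => h.1.ne rfl⟩

/-- A chord would shortcut the walk. -/
theorem not_adj_of_length_eq_dist {G : SimpleGraph V} {a b : V} {p : G.Walk a b}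
    (hp : p.length = G.dist a b) {i j : ℕ} (hij : i + 2 ≤ j) (hj : j ≤ p.length) :
    ¬ G.Adj (p.getVert i) (p.getVert j) := by
  intro h
  have := SimpleGraph.dist_le ((p.take i).append (.cons h (p.drop j)))
  simp at this
  omega

namespace DAG

/-- No two non-adjacent vertices have a common child. -/
def IsMoral (D : DAG V) : Prop :=
  ∀ ⦃a b c⦄, D.Adj a c → D.Adj b c → a ≠ b → D.skeleton.Adj a b

/-- The parents of `a` d-separate `a` from every non-adjacent non-descendant. -/
theorem dsep_parents (D : DAG V) {a c : V} (hac : ¬ D.skeleton.Adj a c) (hne : a ≠ c)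
    (hdesc : ¬ Relation.TransGen D.Adj a c) : D.DSep {a} {c} {x | D.Adj x a} := by
  rintro _ rfl _ rfl p - hact
  have hlen : 2 ≤ p.length := by
    rcases p with _ | ⟨h, _ | ⟨h', q⟩⟩
    · exact absurd rfl hne
    · exact absurd h hac
    · simp
  have hstep : ∀ i, i < p.length → D.Adj (p.getVert i) (p.getVert (i + 1)) := by
    -- An active path cannot start with an arrow into `a`: its second vertex would be a non-collider
    -- in `Z`. The first backward arrow later on would make a collider whose descendant in `Z` is a
    -- parent of `a`, closing a directed cycle.
    have key : ∀ i, i < p.length → D.Adj (p.getVert i) (p.getVert (i + 1)) ∧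
        Relation.TransGen D.Adj (p.getVert 0) (p.getVert (i + 1)) := by
      intro i
      induction i with
      | zero =>
        intro hi
        have : D.Adj (p.getVert 0) (p.getVert (0 + 1)) := by
          rcases p.adj_getVert_succ hi with h | h
          · exact h
          · refine absurd ?_ ((hact 0 hlen).2 fun hc => D.asymm h hc.1)
            simpa using h
        exact ⟨this, .single this⟩
      | succ i ih =>
        intro hi
        obtain ⟨h1, h2⟩ := ih (by omega)
        rcases p.adj_getVert_succ hi with h | h
        · exact ⟨h, h2.tail h⟩
        · obtain ⟨z, hz, hr⟩ := (hact i (by omega)).1 ⟨h1, h⟩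
          rw [p.getVert_zero] at h2
          exact absurd ((h2.trans_left hr).tail hz) (D.acyclic _)
    exact fun i hi => (key i hi).1
  have htrans : ∀ i, i < p.length → Relation.TransGen D.Adj (p.getVert 0) (p.getVert (i + 1)) := by
    intro i
    induction i with
    | zero => exact fun hi => .single (hstep 0 hi)
    | succ i ih => exact fun hi => (ih (by omega)).tail (hstep _ hi)
  have := htrans (p.length - 1) (by omega)
  rw [show p.length - 1 + 1 = p.length by omega, p.getVert_zero, p.getVert_length] at this
  exact hdesc this

/-- By acyclicity one of the two vertices is not a descendant of the other. Allowing either order in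
the conclusion avoids reversing paths. -/
theorem exists_dsep (D : DAG V) {a c : V} (hac : ¬ D.skeleton.Adj a c) (hne : a ≠ c) :
    ∃ Z : Set V, a ∉ Z ∧ c ∉ Z ∧ (D.DSep {a} {c} Z ∨ D.DSep {c} {a} Z) := by
  by_cases h : Relation.TransGen D.Adj a c
  · refine ⟨{x | D.Adj x c}, fun h' => hac (Or.inl h'), D.irrefl c, Or.inr ?_⟩
    exact D.dsep_parents (fun h' => hac h'.symm) hne.symm fun h' => D.acyclic _ (h.trans h')
  · exact ⟨{x | D.Adj x a}, D.irrefl a, fun h' => hac (Or.inr h'),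
      Or.inl (D.dsep_parents hac hne h)⟩

theorem not_dsep_of_adj (D : DAG V) {a c : V} (h : D.skeleton.Adj a c) (Z : Set V) :
    ¬ D.DSep {a} {c} Z := fun hs =>
  hs a rfl c rfl h.toWalk (by simp [h.ne]) fun i hi => absurd hi (by simp)

theorem MarkovEquiv.dsep_singleton_iff {D D' : DAG V} (h : D.MarkovEquiv D') {a c : V}
    {Z : Set V} (hne : a ≠ c) (ha : a ∉ Z) (hc : c ∉ Z) :
    D.DSep {a} {c} Z ↔ D'.DSep {a} {c} Z :=
  h _ _ _ (by simpa using hne) (by simpa using ha) (by simpa using hc)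

theorem MarkovEquiv.skeleton_adj {D D' : DAG V} (h : D.MarkovEquiv D') {a c : V}
    (hac : D.skeleton.Adj a c) : D'.skeleton.Adj a c := by
  by_contra hn
  obtain ⟨Z, ha, hc, hs | hs⟩ := D'.exists_dsep hn hac.ne
  · exact D.not_dsep_of_adj hac Z ((h.dsep_singleton_iff hac.ne ha hc).2 hs)
  · exact D.not_dsep_of_adj hac.symm Z ((h.dsep_singleton_iff hac.ne.symm hc ha).2 hs)

theorem isActive_two (D : DAG V) {a b c : V} (hab : D.skeleton.Adj a b) (hbc : D.skeleton.Adj b c)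
    (Z : Set V) : D.IsActive (.cons hab (.cons hbc .nil)) Z ↔
      (D.Adj a b ∧ D.Adj c b → ∃ z ∈ Z, Relation.ReflTransGen D.Adj b z) ∧
      (¬ (D.Adj a b ∧ D.Adj c b) → b ∉ Z) := by
  constructor
  · intro h
    exact h 0 (by simp)
  · intro h i hi
    obtain rfl : i = 0 := by simpa using hi
    exact h

/-- A set separating `a` from `c` in `D` omits `b`, which would open the collider. If `b` were not a
collider in `D'`, omitting it would leave the path through `b` active there. -/
theorem MarkovEquiv.collider {D D' : DAG V} (h : D.MarkovEquiv D') {a b c : V}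
    (hab : D.Adj a b) (hcb : D.Adj c b) (hne : a ≠ c) (hac : ¬ D.skeleton.Adj a c) :
    D'.Adj a b ∧ D'.Adj c b := by
  obtain ⟨Z, ha, hc, hs⟩ := D.exists_dsep hac hne
  wlog hs' : D.DSep {a} {c} Z generalizing a c
  · exact (this hcb hab hne.symm (fun h' => hac h'.symm) hc ha hs.symm
      (hs.resolve_left hs')).symm
  have key : ∀ E : DAG V, (hab : E.skeleton.Adj a b) → (hbc : E.skeleton.Adj b c) →
      E.DSep {a} {c} Z → ¬ E.IsActive (.cons hab (.cons hbc .nil)) Z := fun E hab hbc hE =>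
    hE a rfl c rfl _ (by simp [hab.ne, hbc.ne, hne])
  have hbZ : b ∉ Z := by
    intro hb
    refine key D (.inl hab) (.inr hcb) hs' ((D.isActive_two _ _ _).2 ⟨fun _ => ⟨b, hb, .refl⟩, ?_⟩)
    exact fun h' => absurd ⟨hab, hcb⟩ h'
  by_contra hn
  exact key D' (h.skeleton_adj (.inl hab)) (h.skeleton_adj (.inr hcb))
    ((h.dsep_singleton_iff hne ha hc).1 hs')
    ((D'.isActive_two _ _ _).2 ⟨fun h' => absurd h' hn, fun _ => hbZ⟩)

/-- A shortest path avoiding `Z` has no collider: morality would join the two neighbours of the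
collider by a chord. -/
theorem IsMoral.exists_active {D : DAG V} (hD : D.IsMoral) {a b : V} {Z : Set V}
    (h : (avoiding D.skeleton Z).Reachable a b) :
    ∃ p : D.skeleton.Walk a b, p.IsPath ∧ D.IsActive p Z := by
  obtain ⟨p, hp, hlen⟩ := h.exists_path_of_dist
  have hle : avoiding D.skeleton Z ≤ D.skeleton := fun _ _ h => h.1
  refine ⟨p.mapLe hle, hp.mapLe hle, fun i hi => ?_⟩
  rw [SimpleGraph.Walk.length_map] at hi
  have hg : ∀ j, (p.mapLe hle).getVert j = p.getVert j := fun j => by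
    simp [SimpleGraph.Walk.mapLe, SimpleGraph.Walk.getVert_map]
  have h1 := p.adj_getVert_succ (show i < p.length by omega)
  have h2 := p.adj_getVert_succ (show i + 1 < p.length by omega)
  refine ⟨fun hc => ?_, fun _ => by rw [hg]; exact h1.2.2⟩
  simp only [IsCollider, hg] at hc
  refine absurd ⟨hD hc.1 hc.2 fun he => ?_, h1.2.1, h2.2.2⟩
    (not_adj_of_length_eq_dist hlen (i := i) (j := i + 2) le_rfl hi)
  have := hp.getVert_injOn (show i ≤ p.length by omega) (show i + 2 ≤ p.length by omega) he
  omega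

/-- Each collider can be bypassed: its neighbours on the path are adjacent by morality and are not
colliders, hence lie outside `Z`. -/
theorem IsMoral.reachable_of_active {D : DAG V} (hD : D.IsMoral) {a b : V} {Z : Set V}
    (ha : a ∉ Z) (hb : b ∉ Z) {p : D.skeleton.Walk a b} (hp : p.IsPath) (hact : D.IsActive p Z) :
    (avoiding D.skeleton Z).Reachable a b := by
  -- vertices of the path with an outgoing edge on it are not colliders
  have hout : ∀ j, j ≤ p.length → (∀ i, j = i + 1 → i + 2 ≤ p.length → ¬ D.IsCollider p i) →
      p.getVert j ∉ Z := by
    intro j hj hc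
    rcases j with _ | i
    · simpa using ha
    · rcases Nat.lt_or_ge (i + 1) p.length with h | h
      · exact (hact i h).2 (hc i rfl h)
      · rw [p.getVert_of_length_le h]; exact hb
  have key : ∀ j, j ≤ p.length → (∀ i, j = i + 1 → i + 2 ≤ p.length → ¬ D.IsCollider p i) →
      (avoiding D.skeleton Z).Reachable a (p.getVert j) := by
    intro j
    induction j using Nat.strong_induction_on with
    | _ j ih =>
      intro hj hc
      rcases j with _ | j
      · simp
      by_cases hcol : ∃ i, j = i + 1 ∧ D.IsCollider p i
      · obtain ⟨i, rfl, hcol⟩ := hcol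
        have hi : ∀ k, i = k + 1 → k + 2 ≤ p.length → ¬ D.IsCollider p k := by
          rintro k rfl - hk
          exact D.asymm hk.2 hcol.1
        refine (ih i (by omega) (by omega) hi).trans (SimpleGraph.Adj.reachable
          ⟨hD hcol.1 hcol.2 fun he => ?_, hout _ (by omega) hi, hout _ hj hc⟩)
        have := hp.getVert_injOn (show i ≤ p.length by omega)
          (show i + 2 ≤ p.length by omega) he
        omega
      · have hj' : ∀ k, j = k + 1 → k + 2 ≤ p.length → ¬ D.IsCollider p k :=
          fun k hk _ h => hcol ⟨k, hk, h⟩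
        exact (ih j (by omega) (by omega) hj').trans (SimpleGraph.Adj.reachable
          ⟨p.adj_getVert_succ (by omega), hout _ (by omega) hj', hout _ hj hc⟩)
  have := key p.length le_rfl fun i h h' => by omega
  rwa [p.getVert_length] at this

/-- In a moral DAG, d-separation is separation in the skeleton. -/
theorem IsMoral.dsep_iff {D : DAG V} (hD : D.IsMoral) {A B Z : Set V} (hA : Disjoint A Z)
    (hB : Disjoint B Z) :
    D.DSep A B Z ↔ ∀ a ∈ A, ∀ b ∈ B, ¬ (avoiding D.skeleton Z).Reachable a b := by
  constructor
  · intro h a ha b hb hr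
    obtain ⟨p, hp, hact⟩ := hD.exists_active hr
    exact h a ha b hb p hp hact
  · intro h a ha b hb p hp hact
    exact h a ha b hb (hD.reachable_of_active (hA.notMem_of_mem_left ha)
      (hB.notMem_of_mem_left hb) hp hact)

theorem IsMoral.markovEquiv {D D' : DAG V} (hD : D.IsMoral) (hD' : D'.IsMoral)
    (h : D.skeleton = D'.skeleton) : D.MarkovEquiv D' := by
  intro A B Z _ hA hB
  rw [hD.dsep_iff hA hB, hD'.dsep_iff hA hB, h]

end DAG

theorem skeleton_eq_and_isMoral_of_mem_markovClass {K : SimpleGraph V} {D : DAG V}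
    (h : D ∈ markovClass (MixedGraph.ofUndirected K)) : D.skeleton = K ∧ D.IsMoral := by
  have hArrow : ∀ a b, ¬ ∀ D' : DAG V, D.MarkovEquiv D' → D'.Adj a b := fun a b h' => by
    have : D.essentialGraph.Arrow a b := h'
    rw [show D.essentialGraph = _ from h] at this
    exact this
  have hLine : ∀ a b, D.essentialGraph.Line a b ↔ K.Adj a b := fun a b => by
    rw [show D.essentialGraph = _ from h]; rfl
  refine ⟨?_, fun a b c hac hbc hne => ?_⟩
  · ext a b
    exact ⟨fun hab => (hLine a b).1 ⟨hab, hArrow a b, hArrow b a⟩, fun hab => ((hLine a b).2 hab).1⟩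
  · by_contra hn
    exact hArrow a c fun D' hD' => (hD'.collider hac hbc hne hn).1

theorem mem_markovClass_of_isMoral {D : DAG V} (hD : D.IsMoral)
    (h : ∀ a b, D.Adj a b → ∃ D' : DAG V, D'.IsMoral ∧ D'.skeleton = D.skeleton ∧ D'.Adj b a) :
    D ∈ markovClass (MixedGraph.ofUndirected D.skeleton) := by
  have hArrow : ∀ a b, ¬ ∀ D' : DAG V, D.MarkovEquiv D' → D'.Adj a b := fun a b h' => by
    obtain ⟨D', hm, hs, hba⟩ := h a b (h' D (.refl D))
    exact D'.asymm hba (h' D' (hD.markovEquiv hm hs.symm))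
  refine MixedGraph.ext ?_ ?_
  · funext a b
    exact propext ⟨fun h' => hArrow a b h', fun h' => h'.elim⟩
  · funext a b
    exact propext ⟨fun h' => h'.1, fun h' => ⟨h', hArrow a b, hArrow b a⟩⟩

/-! ### Chordal graphs and perfect elimination orderings -/

theorem mem_of_mem_support_avoiding {K : SimpleGraph V} {T : Set V} {s t x : V} (hs : s ∈ T)
    (p : (avoiding K Tᶜ).Walk s t) (hx : x ∈ p.support) : x ∈ T := by
  induction p with
  | nil => simp at hx; exact hx ▸ hs
  | cons h p ih =>
    rcases List.mem_cons.1 (by simpa using hx) with rfl | hx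
    · exact hs
    · exact ih (not_not.1 h.2.2) hx

/-- In a chordal graph, two neighbours of `v` that are joined by a path whose inner vertices are
not neighbours of `v` are adjacent. -/
theorem IsChordal.adj_of_reachable {K : SimpleGraph V} (hK : IsChordal K) {v s t : V} {C : Set V}
    (hs : K.Adj v s) (ht : K.Adj v t) (hst : s ≠ t) (hC : ∀ x ∈ C, x ≠ v ∧ ¬ K.Adj v x)
    (hr : (avoiding K (C ∪ {s, t})ᶜ).Reachable s t) : K.Adj s t := by
  by_contra hn
  -- A shortest path closes up through `v` to a chordless cycle of length at least four: `s` and `t`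
  -- are the only neighbours of `v` on it, and a chord of the path would shorten it.
  obtain ⟨p, hp, hlen⟩ := hr.exists_path_of_dist
  have hle : avoiding K (C ∪ {s, t})ᶜ ≤ K := fun _ _ h => h.1
  have hmem : ∀ x ∈ p.support, x ∈ C ∪ {s, t} := fun x hx =>
    mem_of_mem_support_avoiding (by simp) p hx
  have hv : v ∉ p.support := fun h => by
    rcases hmem v h with h | rfl | rfl
    · exact (hC v h).1 rfl
    · exact hs.ne rfl
    · exact ht.ne rfl
  have hsupp : (p.mapLe hle).support = p.support := by simp
  have hedges : (p.mapLe hle).edges = p.edges := by simp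
  have hlength : 2 ≤ p.length := by
    rcases p with _ | ⟨h, _ | ⟨h', q⟩⟩
    · exact absurd rfl hst
    · exact absurd h.1 hn
    · simp
  have hcyc : (SimpleGraph.Walk.cons ht.symm (.cons hs (p.mapLe hle))).IsCycle := by
    rw [SimpleGraph.Walk.cons_isCycle_iff, SimpleGraph.Walk.cons_isPath_iff, hsupp,
      SimpleGraph.Walk.edges_cons, hedges]
    refine ⟨⟨hp.mapLe hle, hv⟩, fun h => ?_⟩
    rcases List.mem_cons.1 h with h | h
    · rw [Sym2.eq_iff] at h
      rcases h with ⟨h, -⟩ | ⟨h, -⟩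
      · exact ht.ne h.symm
      · exact hst h.symm
    · exact hv (p.snd_mem_support_of_mem_edges h)
  have hnbr : ∀ b ∈ p.support, K.Adj v b → b = s ∨ b = t := fun b hb hvb =>
    (hmem b hb).elim (fun h => absurd hvb (hC b h).2) id
  obtain ⟨a, ha, b, hb, hab, he⟩ := hK t _ hcyc (by simp; omega)
  simp only [SimpleGraph.Walk.support_cons, SimpleGraph.Walk.edges_cons, hsupp, hedges,
    List.mem_cons, not_or] at ha hb he
  have ha' : a = v ∨ a ∈ p.support := by
    rcases ha with rfl | h
    · exact Or.inr p.end_mem_support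
    · exact h
  have hb' : b = v ∨ b ∈ p.support := by
    rcases hb with rfl | h
    · exact Or.inr p.end_mem_support
    · exact h
  rcases ha' with rfl | ha'
  · rcases hb' with rfl | hb'
    · exact hab.ne rfl
    · rcases hnbr b hb' hab with rfl | rfl
      · exact he.2.1 rfl
      · exact he.1 Sym2.eq_swap
  rcases hb' with rfl | hb'
  · rcases hnbr a ha' hab.symm with rfl | rfl
    · exact he.2.1 Sym2.eq_swap
    · exact he.1 rfl
  obtain ⟨i, hi, hil⟩ := SimpleGraph.Walk.mem_support_iff_exists_getVert.1 ha'
  obtain ⟨j, hj, hjl⟩ := SimpleGraph.Walk.mem_support_iff_exists_getVert.1 hb'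
  have main : ∀ i j, i < j → j ≤ p.length → K.Adj (p.getVert i) (p.getVert j) →
      s(p.getVert i, p.getVert j) ∈ p.edges := by
    intro i j hij hj hA
    rcases Nat.lt_or_ge (i + 1) j with h | h
    · refine absurd ⟨hA, ?_, ?_⟩ (not_adj_of_length_eq_dist hlen (i := i) (j := j) h hj)
      · exact not_not.2 (hmem _ (p.getVert_mem_support i))
      · exact not_not.2 (hmem _ (p.getVert_mem_support j))
    · obtain rfl : j = i + 1 := by omega
      exact p.adj_toSubgraph_iff_mem_edges.1 (p.toSubgraph_adj_getVert (by omega))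
  subst hi hj
  rcases lt_trichotomy i j with h | rfl | h
  · exact he.2.2 (main i j h hjl hab)
  · exact hab.ne rfl
  · exact he.2.2 (Sym2.eq_swap ▸ main j i h hil hab.symm)

/-- Dirac: in a chordal graph, each vertex set `W` not contained in a clique `Q` has a vertex
outside `Q` whose neighbours in `W` form a clique. -/
theorem IsChordal.exists_simplicial {K : SimpleGraph V} (hK : IsChordal K) (W : Finset V) :
    ∀ Q : Set V, K.IsClique Q → (∃ w ∈ W, w ∉ Q) → ∃ u ∈ W, u ∉ Q ∧
      ∀ x ∈ W, ∀ y ∈ W, K.Adj u x → K.Adj u y → x ≠ y → K.Adj x y := by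
  classical
  induction W using Finset.strongInduction with
  | _ W ih =>
  have main : ∀ Q : Set V, K.IsClique Q → (∃ w ∈ W, w ∉ Q) → (∃ w ∈ W, w ∈ Q) →
      ∃ u ∈ W, u ∉ Q ∧ ∀ x ∈ W, ∀ y ∈ W, K.Adj u x → K.Adj u y → x ≠ y → K.Adj x y := by
    rintro Q hQ ⟨w, hwW, hwQ⟩ ⟨q, hqW, hqQ⟩
    by_cases hdom : ∀ v ∈ W, v ∈ Q → ∀ c ∈ W, c ≠ v → K.Adj v c
    -- Vertices adjacent to everything else in `W` do not affect simpliciality, so `W ∩ Q` can be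
    -- dropped.
    · obtain ⟨u, hu, -, hsimp⟩ := ih (W.filter (· ∉ Q))
        (Finset.filter_ssubset.2 ⟨q, hqW, not_not.2 hqQ⟩) ∅ (by simp)
        ⟨w, by simp [hwW, hwQ], by simp⟩
      rw [Finset.mem_filter] at hu
      refine ⟨u, hu.1, hu.2, fun x hx y hy hux huy hxy => ?_⟩
      by_cases hxQ : x ∈ Q
      · exact hdom x hx hxQ y hy hxy.symm
      by_cases hyQ : y ∈ Q
      · exact (hdom y hy hyQ x hx hxy).symm
      exact hsimp x (by simp [hx, hxQ]) y (by simp [hy, hyQ]) hux huy hxy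
    · push Not at hdom
      obtain ⟨v, hvW, hvQ, c, hcW, hcv, hvc⟩ := hdom
      -- `C` is the component of `c` in `W` minus the closed neighbourhood of `v`, and its boundary
      -- `S` is a clique by chordality. Induction on `C ∪ S` with `S` forbidden gives `u ∈ C`, whose
      -- neighbours in `W` all lie in `C ∪ S`; `u ∉ Q` because `u` is not adjacent to `v ∈ Q`.
      set Z : Set V := {x | x ∉ W ∨ x = v ∨ K.Adj v x} with hZ
      set C : Set V := {x | (avoiding K Z).Reachable c x} with hCdef
      have hcZ : c ∉ Z := by simp [hZ, hcW, hcv, hvc]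
      have hCZ : ∀ x ∈ C, x ∉ Z := by
        intro x hx
        have hx' := (SimpleGraph.reachable_iff_reflTransGen _ _).1 hx
        induction hx' with
        | refl => exact hcZ
        | tail _ h => exact h.2.2
      have hC : ∀ x ∈ C, x ∈ W ∧ x ≠ v ∧ ¬ K.Adj v x := by
        intro x hx
        have := hCZ x hx
        simpa [hZ] using this
      have hCreach : ∀ T : Set V, C ⊆ T → ∀ x ∈ C, (avoiding K Tᶜ).Reachable c x := by
        intro T hT x hx
        have hx' := (SimpleGraph.reachable_iff_reflTransGen _ _).1 hx
        induction hx' with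
        | refl => exact .refl _
        | tail h h' ih =>
          have hmem := (SimpleGraph.reachable_iff_reflTransGen _ _).2 h
          exact (ih hmem).trans (SimpleGraph.Adj.reachable
            ⟨h'.1, not_not.2 (hT hmem), not_not.2 (hT hx)⟩)
      set S : Set V := {s | s ∈ W ∧ K.Adj v s ∧ ∃ x ∈ C, K.Adj s x} with hSdef
      have hS : K.IsClique S := by
        rintro s ⟨-, hvs, x, hxC, hsx⟩ t ⟨-, hvt, y, hyC, hty⟩ hst
        refine hK.adj_of_reachable hvs hvt hst (fun x hx => (hC x hx).2) ?_
        have hT : C ⊆ C ∪ {s, t} := Set.subset_union_left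
        have h1 : (avoiding K (C ∪ {s, t})ᶜ).Adj s x :=
          ⟨hsx, by simp, not_not.2 (hT hxC)⟩
        have h2 : (avoiding K (C ∪ {s, t})ᶜ).Adj t y :=
          ⟨hty, by simp, not_not.2 (hT hyC)⟩
        exact h1.reachable.trans (((hCreach _ hT x hxC).symm.trans (hCreach _ hT y hyC)).trans
          h2.reachable.symm)
      obtain ⟨u, hu, huS, hsimp⟩ := ih (W.filter (fun x => x ∈ C ∨ x ∈ S))
        (Finset.filter_ssubset.2 ⟨v, hvW, by
          rintro (h | h)
          · exact (hC v h).2.1 rfl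
          · exact h.2.1.ne rfl⟩) S hS
        ⟨c, Finset.mem_filter.2 ⟨hcW, Or.inl (.refl _)⟩, fun h => hvc h.2.1⟩
      rw [Finset.mem_filter] at hu
      have huC : u ∈ C := hu.2.resolve_right huS
      have hnbr : ∀ x ∈ W, K.Adj u x → x ∈ W.filter (fun x => x ∈ C ∨ x ∈ S) := by
        intro x hx hux
        refine Finset.mem_filter.2 ⟨hx, ?_⟩
        by_cases hvx : K.Adj v x
        · exact Or.inr ⟨hx, hvx, u, huC, hux.symm⟩
        · refine Or.inl (SimpleGraph.Reachable.trans huC (SimpleGraph.Adj.reachable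
            ⟨hux, hCZ u huC, ?_⟩))
          rintro (h | rfl | h)
          · exact h hx
          · exact (hC u huC).2.2 hux.symm
          · exact hvx h
      refine ⟨u, hu.1, fun huQ => (hC u huC).2.2 (hQ hvQ huQ (hC u huC).2.1.symm),
        fun x hx y hy hux huy => hsimp x (hnbr x hx hux) y (hnbr y hy huy) hux huy⟩
  intro Q hQ ⟨w, hwW, hwQ⟩
  by_cases hne : ∃ q ∈ W, q ∈ Q
  · exact main Q hQ ⟨w, hwW, hwQ⟩ hne
  push Not at hne
  -- When `Q` misses `W`, a singleton in `W` serves as the clique instead.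
  by_cases hw : ∃ w' ∈ W, w' ∉ ({w} : Set V)
  · obtain ⟨u, hu, -, h⟩ := main {w} (by simp) hw ⟨w, hwW, rfl⟩
    exact ⟨u, hu, hne u hu, h⟩
  · push Not at hw
    exact ⟨w, hwW, hwQ, fun x hx y hy _ _ hxy => absurd ((hw x hx).trans (hw y hy).symm) hxy⟩

/-- `σ` ranks the vertices such that the earlier neighbours of each vertex form a clique: the
reverse of `σ` is a perfect elimination ordering. -/
structure IsPEO (G : SimpleGraph V) (σ : V → ℕ) : Prop where
  ne : ∀ ⦃a b⦄, G.Adj a b → σ a ≠ σ b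
  clique : ∀ ⦃a b c⦄, G.Adj a c → G.Adj b c → σ a < σ c → σ b < σ c → a ≠ b → G.Adj a b

/-- Every vertex can come first in the reverse of a perfect elimination ordering. -/
def Rootable (G : SimpleGraph V) : Prop :=
  ∀ s : Set V, s.Subsingleton → ∃ σ : V → ℕ, IsPEO G σ ∧ ∀ v ∈ s, ∀ u, u ≠ v → σ v < σ u

/-- A simplicial vertex outside the clique `s` is ranked last and removed, until only `s` is left.
Allowing `s` to be empty yields an ordering even on an empty vertex set. -/
theorem IsChordal.rootable [Finite V] {K : SimpleGraph V} (hK : IsChordal K) : Rootable K := by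
  classical
  have := Fintype.ofFinite V
  intro s hs
  have main : ∀ W : Finset V, ∃ σ : V → ℕ, (∀ a ∈ W, ∀ b ∈ W, K.Adj a b → σ a ≠ σ b) ∧
      (∀ a ∈ W, ∀ b ∈ W, ∀ c ∈ W, K.Adj a c → K.Adj b c → σ a < σ c → σ b < σ c → a ≠ b →
        K.Adj a b) ∧ ∀ v ∈ W, v ∈ s → ∀ u ∈ W, u ≠ v → σ v < σ u := by
    intro W
    induction W using Finset.strongInduction with
    | _ W ih =>
    by_cases hW : ∃ w ∈ W, w ∉ s
    · obtain ⟨u, hu, hus, hsimp⟩ := hK.exists_simplicial W s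
        (fun a ha b hb hab => absurd (hs ha hb) hab) hW
      obtain ⟨σ, h1, h2, h3⟩ := ih (W.erase u) (Finset.erase_ssubset hu)
      have hlt : ∀ x, σ x < Finset.univ.sup σ + 1 := fun x =>
        Nat.lt_succ_of_le (Finset.le_sup (Finset.mem_univ x))
      set τ := Function.update σ u (Finset.univ.sup σ + 1) with hτ
      have hτu : τ u = Finset.univ.sup σ + 1 := by simp [hτ]
      have hτx : ∀ x, x ≠ u → τ x = σ x := fun x hx => by simp [hτ, hx]
      have hle : ∀ x, x ≠ u → τ x < τ u := fun x hx => by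
        rw [hτu, hτx x hx]; exact hlt x
      refine ⟨τ, fun a ha b hb hab => ?_, fun a ha b hb c hc hac hbc hla hlb hne => ?_,
        fun v hv hvs x hx hxv => ?_⟩
      · by_cases hau : a = u
        · subst hau; exact (hle b hab.ne.symm).ne'
        by_cases hbu : b = u
        · subst hbu; exact (hle a hau).ne
        rw [hτx a hau, hτx b hbu]
        exact h1 a (by simp [*]) b (by simp [*]) hab
      · by_cases hcu : c = u
        · subst hcu; exact hsimp a ha b hb hac.symm hbc.symm hne
        have hau : a ≠ u := by rintro rfl; exact absurd (hle c hcu) hla.asymm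
        have hbu : b ≠ u := by rintro rfl; exact absurd (hle c hcu) hlb.asymm
        rw [hτx _ hau, hτx _ hcu] at hla
        rw [hτx _ hbu, hτx _ hcu] at hlb
        exact h2 a (by simp [*]) b (by simp [*]) c (by simp [*]) hac hbc hla hlb hne
      · have hvu : v ≠ u := by rintro rfl; exact hus hvs
        by_cases hxu : x = u
        · subst hxu; exact hle v hvu
        rw [hτx _ hvu, hτx _ hxu]
        exact h3 v (by simp [*]) hvs x (by simp [*]) hxv
    · push Not at hW
      have hsub : ∀ a ∈ W, ∀ b ∈ W, a = b := fun a ha b hb => hs (hW a ha) (hW b hb)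
      exact ⟨fun _ => 0, fun a ha b hb hab => absurd (hsub a ha b hb) hab.ne,
        fun a ha b hb _ _ _ _ _ _ hab => absurd (hsub a ha b hb) hab,
        fun v hv _ u hu huv => absurd (hsub u hu v hv) huv⟩
  obtain ⟨σ, h1, h2, h3⟩ := main Finset.univ
  exact ⟨σ, ⟨fun a b => h1 a (Finset.mem_univ _) b (Finset.mem_univ _),
    fun a b c => h2 a (Finset.mem_univ _) b (Finset.mem_univ _) c (Finset.mem_univ _)⟩,
    fun v hv u => h3 v (Finset.mem_univ _) hv u (Finset.mem_univ _)⟩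

theorem Rootable.comap {W : Type*} {G : SimpleGraph V} (hG : Rootable G) (e : W ↪ V) :
    Rootable (G.comap e) := by
  intro s hs
  obtain ⟨σ, h1, h2⟩ := hG (e '' s) (hs.image e)
  exact ⟨σ ∘ e, ⟨fun a b hab => h1.ne hab,
    fun a b c hac hbc hla hlb hne => h1.clique hac hbc hla hlb (e.injective.ne hne)⟩,
    fun v hv u huv => h2 _ ⟨v, hv, rfl⟩ _ (e.injective.ne huv)⟩

/-! ### Dominating vertices preserve rootability -/

section extended

variable {K : SimpleGraph V} {m : ℕ}

@[simp] theorem extended_inl_inl {a b : V} :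
    (extended K m).Adj (.inl a) (.inl b) ↔ K.Adj a b := by simp [extended]

@[simp] theorem extended_inl_inr {a : V} {i : Fin m} :
    (extended K m).Adj (.inl a) (.inr i) := by simp [extended]

@[simp] theorem extended_inr_inl {a : V} {i : Fin m} :
    (extended K m).Adj (.inr i) (.inl a) := by simp [extended]

@[simp] theorem extended_inr_inr {i j : Fin m} :
    (extended K m).Adj (.inr i) (.inr j) ↔ i ≠ j := by simp [extended]

theorem extended_adj_inr {x : V ⊕ Fin m} {i : Fin m} :
    (extended K m).Adj x (.inr i) ↔ x ≠ .inr i := by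
  rcases x with a | j <;> simp

theorem Rootable.extended (hK : Rootable K) (m : ℕ) : Rootable (extended K m) := by
  classical
  intro s hs
  obtain ⟨σ, h1, h2⟩ := hK (Sum.inl ⁻¹' s) (hs.preimage Sum.inl_injective)
  -- The prescribed root comes first, then the new vertices, then the old ones in their former
  -- order. Thus at most one old vertex precedes a new one.
  let τ : V ⊕ Fin m → ℕ := fun x => if x ∈ s then 0 else
    Sum.elim (fun a => σ a + m + 1) (fun i : Fin m => (i : ℕ) + 1) x
  have hτs : ∀ x ∈ s, τ x = 0 := fun x hx => by simp [τ, hx]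
  have hτl : ∀ a, .inl a ∉ s → τ (.inl a) = σ a + m + 1 := fun a ha => by simp [τ, ha]
  have hτr : ∀ i, .inr i ∉ s → τ (.inr i) = i + 1 := fun a ha => by simp [τ, ha]
  have hpos : ∀ x, x ∉ s → 0 < τ x := by
    rintro (a | i) hx
    · rw [hτl a hx]; omega
    · rw [hτr i hx]; omega
  have hmono : ∀ a b, a ≠ b → τ (.inl a) < τ (.inl b) → σ a < σ b := by
    intro a b hab h
    by_cases ha : .inl a ∈ s
    · exact h2 a ha b hab.symm
    by_cases hb : .inl b ∈ s
    · rw [hτs _ hb] at h; omega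
    · rw [hτl a ha, hτl b hb] at h; omega
  refine ⟨τ, ⟨fun x y hxy => ?_, fun x y z hxz hyz hlx hly hne => ?_⟩, fun v hv u huv => ?_⟩
  · by_cases hx : x ∈ s
    · by_cases hy : y ∈ s
      · exact absurd (hs hx hy) hxy.ne
      · rw [hτs _ hx]; exact (hpos y hy).ne
    by_cases hy : y ∈ s
    · rw [hτs _ hy]; exact (hpos x hx).ne'
    rcases x with a | i <;> rcases y with b | j
    · rw [hτl a hx, hτl b hy]
      have := h1.ne (extended_inl_inl.1 hxy)
      omega
    · rw [hτl a hx, hτr j hy]; omega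
    · rw [hτr i hx, hτl b hy]; omega
    · rw [hτr i hx, hτr j hy]
      have := Fin.val_ne_of_ne (extended_inr_inr.1 hxy)
      omega
  · rcases x with a | i
    · rcases y with b | j
      · rcases z with c | k
        · rw [extended_inl_inl] at *
          exact h1.clique hxz hyz (hmono a c hxz.ne hlx) (hmono b c hyz.ne hly) (by simpa using hne)
        · exfalso
          by_cases hk : .inr k ∈ s
          · rw [hτs _ hk] at hlx; omega
          rw [hτr k hk] at hlx hly
          by_cases ha : .inl a ∈ s
          · by_cases hb : .inl b ∈ s
            · exact hne (hs ha hb)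
            · rw [hτl b hb] at hly; omega
          · rw [hτl a ha] at hlx; omega
      · exact extended_adj_inr.2 hne
    · exact (extended_adj_inr.2 hne.symm).symm
  · rw [hτs v hv]
    exact hpos u fun hu => huv (hs hu hv)

end extended

/-! ### Sizes as numbers of acyclic moral orientations -/

/-- `r` is an acyclic orientation of `G` in which no two non-adjacent vertices have a common
child. -/
structure IsAMO (G : SimpleGraph V) (r : V → V → Prop) : Prop where
  adj : ∀ a b, G.Adj a b ↔ r a b ∨ r b a
  acyclic : ∀ v, ¬ Relation.TransGen r v v
  moral : ∀ ⦃a b c⦄, r a c → r b c → a ≠ b → G.Adj a b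

/-- The acyclic moral orientations of `G`. -/
def amo (G : SimpleGraph V) : Set (V → V → Prop) := {r | IsAMO G r}

/-- The acyclic moral orientations of `G` with root `v`. -/
def rootedAmo (G : SimpleGraph V) (v : V) : Set (V → V → Prop) :=
  {r | IsAMO G r ∧ ∀ u, ¬ r u v}

theorem IsPEO.isAMO {G : SimpleGraph V} {σ : V → ℕ} (h : IsPEO G σ) :
    IsAMO G fun a b => G.Adj a b ∧ σ a < σ b where
  adj a b := by
    constructor
    · intro hab
      rcases (h.ne hab).lt_or_gt with h' | h'
      · exact Or.inl ⟨hab, h'⟩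
      · exact Or.inr ⟨hab.symm, h'⟩
    · rintro (h | h)
      · exact h.1
      · exact h.1.symm
  acyclic v hv := by
    have : ∀ w, Relation.TransGen (fun a b => G.Adj a b ∧ σ a < σ b) v w → σ v < σ w := by
      intro w hw
      induction hw with
      | single h => exact h.2
      | tail _ h ih => exact ih.trans h.2
    exact (this v hv).false
  moral _ _ _ ha hb hne := h.clique ha.1 hb.1 ha.2 hb.2 hne

theorem Rootable.exists_isAMO {G : SimpleGraph V} (hG : Rootable G) (s : Set V)
    (hs : s.Subsingleton) : ∃ r, IsAMO G r ∧ ∀ v ∈ s, ∀ u, G.Adj v u → r v u := by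
  obtain ⟨σ, h, h'⟩ := hG s hs
  exact ⟨_, h.isAMO, fun v hv u hvu => ⟨hvu, h' v hv u hvu.ne.symm⟩⟩

/-- The DAG of an acyclic moral orientation. -/
def IsAMO.toDAG {G : SimpleGraph V} {r : V → V → Prop} (h : IsAMO G r) : DAG V where
  Adj := r
  acyclic := h.acyclic

theorem IsAMO.skeleton_toDAG {G : SimpleGraph V} {r : V → V → Prop} (h : IsAMO G r) :
    h.toDAG.skeleton = G := by
  ext a b; exact (h.adj a b).symm

theorem IsAMO.isMoral_toDAG {G : SimpleGraph V} {r : V → V → Prop} (h : IsAMO G r) :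
    h.toDAG.IsMoral := fun a b c hac hbc hab => by
  rw [h.skeleton_toDAG]; exact h.moral hac hbc hab

theorem DAG.adj_injective : Function.Injective fun D : DAG V => D.Adj := by
  rintro ⟨⟨r⟩, h⟩ ⟨⟨r'⟩, h'⟩ rfl
  rfl

/-- An arrow into `b` is reversed by an AMO rooted at `b`, which is Markov equivalent; so the
essential graph has no arrows. -/
theorem Rootable.mem_markovClass_iff {G : SimpleGraph V} (hG : Rootable G) {D : DAG V} :
    D ∈ markovClass (MixedGraph.ofUndirected G) ↔ IsAMO G D.Adj := by
  constructor
  · intro h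
    obtain ⟨rfl, hm⟩ := skeleton_eq_and_isMoral_of_mem_markovClass h
    exact ⟨fun a b => Iff.rfl, D.acyclic, hm⟩
  · intro h
    have hs : D.skeleton = G := h.skeleton_toDAG
    have hm : D.IsMoral := h.isMoral_toDAG
    rw [← hs]
    refine mem_markovClass_of_isMoral hm fun a b hab => ?_
    obtain ⟨r, hr, hrb⟩ := hG.exists_isAMO {b} Set.subsingleton_singleton
    refine ⟨hr.toDAG, hr.isMoral_toDAG, hr.skeleton_toDAG.trans hs.symm, hrb b rfl a ?_⟩
    exact (h.adj b a).2 (Or.inr hab)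

theorem Rootable.size_eq {G : SimpleGraph V} (hG : Rootable G) :
    Size (MixedGraph.ofUndirected G) = (amo G).ncard := by
  have : amo G = (fun D : DAG V => D.Adj) '' markovClass (MixedGraph.ofUndirected G) := by
    ext r
    constructor
    · intro h
      exact ⟨h.toDAG, hG.mem_markovClass_iff.2 h, rfl⟩
    · rintro ⟨D, hD, rfl⟩
      exact hG.mem_markovClass_iff.1 hD
  rw [this, Set.ncard_image_of_injective _ DAG.adj_injective, Size]

/-- The skeleton recovers `U`, so the existential in `RootedSize` has only the intended witness. -/
theorem rootedEssentialGraph_injective (v : V) :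
    Function.Injective fun U : SimpleGraph V => rootedEssentialGraph U v := by
  have key : ∀ (U : SimpleGraph V) a b, U.Adj a b ↔ (rootedEssentialGraph U v).Arrow a b ∨
      (rootedEssentialGraph U v).Arrow b a ∨ (rootedEssentialGraph U v).Line a b := by
    intro U a b
    constructor
    · intro h
      by_cases h1 : RootedArrow U v a b
      · exact Or.inl h1
      by_cases h2 : RootedArrow U v b a
      · exact Or.inr (Or.inl h2)
      · exact Or.inr (Or.inr ⟨h, h1, h2⟩)
    · rintro (h | h | h)
      · exact h.1
      · exact h.1.symm
      · exact h.1
  intro U U' h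
  ext a b
  rw [key U, key U', show rootedEssentialGraph U v = _ from h]

theorem Rootable.rootedSize_eq {G : SimpleGraph V} (hG : Rootable G) (v : V) :
    RootedSize (rootedEssentialGraph G v) v = (rootedAmo G v).ncard := by
  have : rootedAmo G v = (fun D : DAG V => D.Adj) '' {D : DAG V | ∃ U : SimpleGraph V,
      rootedEssentialGraph U v = rootedEssentialGraph G v ∧ D ∈ rootedSubclass U v} := by
    ext r
    constructor
    · intro h
      exact ⟨h.1.toDAG, ⟨G, rfl, hG.mem_markovClass_iff.2 h.1, h.2⟩, rfl⟩
    · rintro ⟨D, ⟨U, hU, hD, hroot⟩, rfl⟩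
      obtain rfl := rootedEssentialGraph_injective v hU
      exact ⟨hG.mem_markovClass_iff.1 hD, hroot⟩
  rw [this, Set.ncard_image_of_injective _ DAG.adj_injective, RootedSize]

variable {W : Type*}

theorem IsAMO.comap {G : SimpleGraph V} {r : V → V → Prop} (h : IsAMO G r) (e : W ↪ V) :
    IsAMO (G.comap e) (fun a b => r (e a) (e b)) where
  adj _ _ := h.adj _ _
  acyclic _ hv := h.acyclic _ (hv.lift e fun _ _ h => h)
  moral _ _ _ ha hb hne := h.moral ha hb (e.injective.ne hne)

theorem bijOn_rootedAmo_comap (G : SimpleGraph V) (e : W ≃ V) (v : W) :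
    Set.BijOn (fun (r : V → V → Prop) a b => r (e a) (e b)) (rootedAmo G (e v))
      (rootedAmo (G.comap e) v) := by
  refine ⟨fun r h => ⟨h.1.comap e.toEmbedding, fun u => h.2 (e u)⟩, fun r _ r' _ h => ?_,
    fun r h => ⟨fun a b => r (e.symm a) (e.symm b), ⟨?_, fun u => by simpa using h.2 _⟩, by simp⟩⟩
  · funext a b
    simpa using congrFun₂ h (e.symm a) (e.symm b)
  · have := h.1.comap e.symm.toEmbedding
    rwa [show (G.comap e).comap e.symm.toEmbedding = G by ext; simp] at this

theorem bijOn_amo_comap (G : SimpleGraph V) (e : W ≃ V) :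
    Set.BijOn (fun (r : V → V → Prop) a b => r (e a) (e b)) (amo G) (amo (G.comap e)) := by
  refine ⟨fun r h => IsAMO.comap h e.toEmbedding, fun r _ r' _ h => ?_,
    fun r h => ⟨fun a b => r (e.symm a) (e.symm b), ?_, by simp⟩⟩
  · funext a b
    simpa using congrFun₂ h (e.symm a) (e.symm b)
  · have := IsAMO.comap h e.symm.toEmbedding
    rwa [show (G.comap e).comap e.symm.toEmbedding = G by ext; simp] at this

theorem ncard_eq_of_bijOn {α β : Type*} {f : α → β} {s : Set α} {t : Set β}
    (h : Set.BijOn f s t) : s.ncard = t.ncard := by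
  rw [← h.image_eq, h.injOn.ncard_image]

/-! ### Decomposition of an orientation at its root -/

section glue

variable {A O : Type*} (G : SimpleGraph (Option (A ⊕ O)))

/-- The orientation of a graph in which `none` is a root with children `A` and all edges between
`A` and `O` point to `O`, with given orientations within `A` and `O`. -/
def glue (β : A → A → Prop) (δ : O → O → Prop) : Option (A ⊕ O) → Option (A ⊕ O) → Prop
  | none, some (.inl _) => True
  | some (.inl a), some (.inl b) => β a b
  | some (.inl a), some (.inr o) => G.Adj (some (.inl a)) (some (.inr o))
  | some (.inr o), some (.inr o') => δ o o'
  | _, _ => False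

/-- The subgraph induced on `A`. -/
abbrev innerGraph : SimpleGraph A := G.comap fun a => some (.inl a)

/-- The subgraph induced on `O`. -/
abbrev outerGraph : SimpleGraph O := G.comap fun o => some (.inr o)

/-- The orientations within `O` that `none`-rooted acyclic moral orientations induce. -/
structure IsOuter (δ : O → O → Prop) : Prop where
  isAMO : IsAMO (outerGraph G) δ
  clique : ∀ a b o, G.Adj (some (.inl a)) (some (.inr o)) → G.Adj (some (.inl b)) (some (.inr o)) →
    a ≠ b → G.Adj (some (.inl a)) (some (.inl b))
  adj : ∀ a o o', G.Adj (some (.inl a)) (some (.inr o')) → δ o o' →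
    G.Adj (some (.inl a)) (some (.inr o))

variable {G}

/-- No arrow leads back from `O` to `A` or into `none`, so a cycle would stay within `A` or within
`O`. -/
theorem acyclic_glue {β : A → A → Prop} {δ : O → O → Prop}
    (hβ : ∀ v, ¬ Relation.TransGen β v v) (hδ : ∀ v, ¬ Relation.TransGen δ v v)
    (v : Option (A ⊕ O)) : ¬ Relation.TransGen (glue G β δ) v v := by
  have hO : ∀ o y, Relation.TransGen (glue G β δ) (some (.inr o)) y →
      ∃ o', y = some (.inr o') ∧ Relation.TransGen δ o o' := by
    intro o y h
    induction h with
    | @single y h =>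
      rcases y with _ | a | o'
      · exact h.elim
      · exact h.elim
      · exact ⟨o', rfl, .single h⟩
    | @tail _ z _ h ih =>
      obtain ⟨o', rfl, h'⟩ := ih
      rcases z with _ | a | o''
      · exact h.elim
      · exact h.elim
      · exact ⟨o'', rfl, h'.tail h⟩
  have hA : ∀ a y, Relation.TransGen (glue G β δ) (some (.inl a)) y →
      (∃ a', y = some (.inl a') ∧ Relation.TransGen β a a') ∨ ∃ o, y = some (.inr o) := by
    intro a y h
    induction h with
    | @single y h =>
      rcases y with _ | a' | o'
      · exact h.elim
      · exact Or.inl ⟨a', rfl, .single h⟩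
      · exact Or.inr ⟨o', rfl⟩
    | @tail _ z _ h ih =>
      rcases z with _ | a' | o''
      · rcases ih with ⟨a', rfl, -⟩ | ⟨o, rfl⟩ <;> exact h.elim
      · rcases ih with ⟨a', rfl, h'⟩ | ⟨o, rfl⟩
        · exact Or.inl ⟨_, rfl, h'.tail h⟩
        · exact h.elim
      · exact Or.inr ⟨o'', rfl⟩
  intro h
  rcases v with _ | a | o
  · rcases Relation.TransGen.tail'_iff.1 h with ⟨_ | a | o, -, h'⟩ <;> exact h'.elim
  · rcases hA a _ h with ⟨a', h1, h2⟩ | ⟨o, ho⟩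
    · cases h1; exact hβ _ h2
    · cases ho
  · obtain ⟨o', h1, h2⟩ := hO o _ h
    cases h1; exact hδ _ h2

theorem isAMO_glue (hA : ∀ a, G.Adj none (some (.inl a))) (hO : ∀ o, ¬ G.Adj none (some (.inr o)))
    {β : A → A → Prop} {δ : O → O → Prop} (hβ : IsAMO (innerGraph G) β) (hδ : IsOuter G δ) :
    IsAMO G (glue G β δ) where
  adj x y := by
    rcases x with _ | a | o <;> rcases y with _ | b | o'
    · simp [glue]
    · simp [glue, hA]
    · simp [glue, hO]
    · simp [glue, (hA a).symm]
    · exact hβ.adj a b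
    · simp [glue]
    · simpa [glue] using fun h => hO o h.symm
    · simp [glue, G.adj_comm]
    · exact hδ.isAMO.adj o o'
  acyclic := acyclic_glue hβ.acyclic hδ.isAMO.acyclic
  moral x y z hx hy hne := by
    rcases z with _ | c | o
    · rcases x with _ | a | p <;> exact hx.elim
    · rcases x with _ | a | p
      · rcases y with _ | b | q
        · exact absurd rfl hne
        · exact hA b
        · exact hy.elim
      · rcases y with _ | b | q
        · exact (hA a).symm
        · exact hβ.moral hx hy fun h => hne (h ▸ rfl)
        · exact hy.elim
      · exact hx.elim
    · rcases x with _ | a | p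
      · exact hx.elim
      · rcases y with _ | b | q
        · exact hy.elim
        · exact hδ.clique a b o hx hy fun h => hne (h ▸ rfl)
        · exact hδ.adj a q o hx hy
      · rcases y with _ | b | q
        · exact hy.elim
        · exact (hδ.adj b p o hy hx).symm
        · exact hδ.isAMO.moral hx hy fun h => hne (h ▸ rfl)

/-- Otherwise the root and `o` would be non-adjacent parents of `a`. -/
theorem IsAMO.apply_inl_inr (hA : ∀ a, G.Adj none (some (.inl a)))
    (hO : ∀ o, ¬ G.Adj none (some (.inr o))) {r : Option (A ⊕ O) → Option (A ⊕ O) → Prop}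
    (h : IsAMO G r) (hr : ∀ u, ¬ r u none) {a : A} {o : O}
    (hao : G.Adj (some (.inl a)) (some (.inr o))) : r (some (.inl a)) (some (.inr o)) := by
  refine ((h.adj _ _).1 hao).resolve_right fun h' => hO o ?_
  exact h.moral (((h.adj _ _).1 (hA a)).resolve_right (hr _)) h' (by simp)

/-- The root forces every edge not inside `A` or `O`. The set of choices is a product because
`IsOuter` does not mention the orientation within `A`. -/
theorem bijOn_glue (hA : ∀ a, G.Adj none (some (.inl a))) (hO : ∀ o, ¬ G.Adj none (some (.inr o))) :
    Set.BijOn (fun p : (A → A → Prop) × (O → O → Prop) => glue G p.1 p.2)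
      (amo (innerGraph G) ×ˢ {δ | IsOuter G δ}) (rootedAmo G none) := by
  refine ⟨fun p hp => ⟨isAMO_glue hA hO hp.1 hp.2, ?_⟩, fun p _ q _ h => ?_, fun r hr => ?_⟩
  · rintro (_ | a | o) h <;> exact h
  · refine Prod.ext ?_ ?_
    · funext a b
      exact congrFun₂ h (some (.inl a)) (some (.inl b))
    · funext a b
      exact congrFun₂ h (some (.inr a)) (some (.inr b))
  · have hao : ∀ {a o}, G.Adj (some (.inl a)) (some (.inr o)) →
        r (some (.inl a)) (some (.inr o)) := hr.1.apply_inl_inr hA hO hr.2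
    have hasymm : ∀ x y, r x y → ¬ r y x := fun x y h h' => hr.1.acyclic x (.tail (.single h) h')
    have hadj : ∀ {x y}, r x y → G.Adj x y := fun h => (hr.1.adj _ _).2 (Or.inl h)
    refine ⟨⟨fun a b => r (some (.inl a)) (some (.inl b)),
      fun a b => r (some (.inr a)) (some (.inr b))⟩,
      ⟨hr.1.comap (Function.Embedding.inl.trans Function.Embedding.some),
      hr.1.comap (Function.Embedding.inr.trans Function.Embedding.some), ?_, ?_⟩, ?_⟩
    · intro a b o ha hb hne
      exact hr.1.moral (hao ha) (hao hb) (by simpa using hne)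
    · intro a o o' ha h
      exact hr.1.moral (hao ha) h (by simp)
    · funext x y
      apply propext
      rcases y with _ | b | o'
      · have := hr.2 x
        rcases x with _ | a | o <;> simpa [glue] using this
      · rcases x with _ | a | o
        · simpa [glue] using ((hr.1.adj _ _).1 (hA b)).resolve_right (hr.2 _)
        · rfl
        · simp only [glue, false_iff]
          exact fun h => hasymm _ _ h (hao (hadj h).symm)
      · rcases x with _ | a | o
        · simp only [glue, false_iff]
          exact fun h => hO _ (hadj h)
        · exact ⟨hao, hadj⟩
        · rfl

theorem ncard_rootedAmo_none (hA : ∀ a, G.Adj none (some (.inl a)))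
    (hO : ∀ o, ¬ G.Adj none (some (.inr o))) :
    (rootedAmo G none).ncard = (amo (innerGraph G)).ncard * {δ | IsOuter G δ}.ncard := by
  rw [← ncard_eq_of_bijOn (bijOn_glue hA hO), Set.ncard_prod]

end glue

/-! ### Rooted counts in the extended graph -/

/-- The vertices apart from `v` and its neighbours. -/
abbrev Far (K : SimpleGraph V) (v : V) := {u // u ≠ v ∧ ¬ K.Adj v u}

/-- The vertices of `K^{m+}`, split into an old vertex `v`, its neighbours and the others. -/
noncomputable def splitOld (K : SimpleGraph V) (m : ℕ) (v : V) :
    Option ((K.neighborSet v ⊕ Fin m) ⊕ Far K v) ≃ V ⊕ Fin m :=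
  Equiv.ofBijective (fun x => x.elim (.inl v)
    (Sum.elim (Sum.map (↑) id) fun u => .inl u)) <| by
    constructor
    · rintro (_ | (⟨a, ha⟩ | i) | ⟨o, ho, ho'⟩) (_ | (⟨b, hb⟩ | j) | ⟨p, hp, hp'⟩) h <;>
        simp at h ⊢ <;> grind [SimpleGraph.irrefl, SimpleGraph.mem_neighborSet]
    · rintro (a | i)
      · by_cases hav : a = v
        · exact ⟨none, by simp [hav]⟩
        by_cases ha : K.Adj v a
        · exact ⟨some (.inl (.inl ⟨a, ha⟩)), rfl⟩
        · exact ⟨some (.inr ⟨a, hav, ha⟩), rfl⟩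
      · exact ⟨some (.inl (.inr i)), rfl⟩

/-- The vertices of `K`, split into `v`, its neighbours and the others. -/
noncomputable def split (K : SimpleGraph V) (v : V) :
    Option (K.neighborSet v ⊕ Far K v) ≃ V :=
  Equiv.ofBijective (fun x => x.elim v (Sum.elim (↑) (↑))) <| by
    constructor
    · rintro (_ | ⟨a, ha⟩ | ⟨o, ho, ho'⟩) (_ | ⟨b, hb⟩ | ⟨p, hp, hp'⟩) h <;>
        simp at h ⊢ <;> grind [SimpleGraph.irrefl, SimpleGraph.mem_neighborSet]
    · intro a
      by_cases hav : a = v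
      · exact ⟨none, by simp [hav]⟩
      by_cases ha : K.Adj v a
      · exact ⟨some (.inl ⟨a, ha⟩), rfl⟩
      · exact ⟨some (.inr ⟨a, hav, ha⟩), rfl⟩

/-- The vertices of `K^{(m+1)+}`, split into a new vertex and its neighbours. -/
noncomputable def splitNew (V : Type*) (m : ℕ) (i : Fin (m + 1)) :
    Option ((V ⊕ Fin m) ⊕ Empty) ≃ V ⊕ Fin (m + 1) :=
  Equiv.ofBijective (fun x => x.elim (.inr i) (Sum.elim (Sum.map id i.succAbove) Empty.elim)) <| by
    constructor
    · rintro (_ | (a | j) | o) (_ | (b | k) | p) h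
      all_goals first | exact o.elim | exact p.elim | skip
      all_goals simp_all [Fin.succAbove_ne, (Fin.succAbove_ne _ _).symm]
    · rintro (a | j)
      · exact ⟨some (.inl (.inl a)), rfl⟩
      · by_cases hj : j = i
        · exact ⟨none, by simp [hj]⟩
        · obtain ⟨k, rfl⟩ := Fin.exists_succAbove_eq hj
          exact ⟨some (.inl (.inr k)), rfl⟩

theorem ncard_rootedAmo (K : SimpleGraph V) (v : V) :
    (rootedAmo K v).ncard =
      (amo (nbrGraph K v)).ncard * {δ | IsOuter (K.comap (split K v)) δ}.ncard := by
  rw [show v = split K v none from rfl, ncard_eq_of_bijOn (bijOn_rootedAmo_comap K (split K v) none),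
    ncard_rootedAmo_none (fun a => a.2) (fun o => o.2.2)]
  rfl

/-- The new vertices are adjacent to everything, so the outer conditions involving them hold
automatically. -/
theorem isOuter_splitOld_iff (K : SimpleGraph V) (m : ℕ) (v : V) (δ : Far K v → Far K v → Prop) :
    IsOuter ((extended K m).comap (splitOld K m v)) δ ↔ IsOuter (K.comap (split K v)) δ := by
  have hG : outerGraph ((extended K m).comap (splitOld K m v)) =
      outerGraph (K.comap (split K v)) := by
    ext a b; exact extended_inl_inl
  have hAO : ∀ (a : K.neighborSet v) (o : Far K v),
      ((extended K m).comap (splitOld K m v)).Adj (some (.inl (.inl a))) (some (.inr o)) ↔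
        (K.comap (split K v)).Adj (some (.inl a)) (some (.inr o)) := fun _ _ => extended_inl_inl
  have hAA : ∀ a b : K.neighborSet v,
      ((extended K m).comap (splitOld K m v)).Adj (some (.inl (.inl a))) (some (.inl (.inl b))) ↔
        (K.comap (split K v)).Adj (some (.inl a)) (some (.inl b)) := fun _ _ => extended_inl_inl
  constructor
  · intro h
    refine ⟨hG ▸ h.isAMO, fun a b o ha hb hne => ?_, fun a o o' ha ho => ?_⟩
    · exact (hAA a b).1 (h.clique _ _ o ((hAO a o).2 ha) ((hAO b o).2 hb) (by simpa using hne))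
    · exact (hAO a o).1 (h.adj _ o o' ((hAO a o').2 ha) ho)
  · intro h
    refine ⟨hG ▸ h.isAMO, fun a b o ha hb hne => ?_, fun a o o' ha ho => ?_⟩
    · rcases a with a | i
      · rcases b with b | j
        · exact (hAA a b).2 (h.clique a b o ((hAO a o).1 ha) ((hAO b o).1 hb) (by simpa using hne))
        · exact extended_inl_inr
      · rcases b with b | j
        · exact extended_inr_inl
        · exact extended_inr_inr.2 (by simpa using hne)
    · rcases a with a | i
      · exact (hAO a o).2 (h.adj a o o' ((hAO a o').1 ha) ho)
      · exact extended_inr_inl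

theorem ncard_rootedAmo_extended_inl (K : SimpleGraph V) (m : ℕ) (v : V) :
    (rootedAmo (extended K m) (.inl v)).ncard = (amo (extended (nbrGraph K v) m)).ncard *
      {δ | IsOuter (K.comap (split K v)) δ}.ncard := by
  rw [show Sum.inl v = splitOld K m v none from rfl,
    ncard_eq_of_bijOn (bijOn_rootedAmo_comap (extended K m) (splitOld K m v) none),
    ncard_rootedAmo_none (fun a => ?_) (fun o h => o.2.2 (extended_inl_inl.1 h))]
  · simp only [isOuter_splitOld_iff]
    congr 3
    ext a b
    rcases a with a | i <;> rcases b with b | j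
    · rw [extended_inl_inl]; exact extended_inl_inl
    · exact iff_of_true extended_inl_inr extended_inl_inr
    · exact iff_of_true extended_inr_inl extended_inr_inl
    · rw [extended_inr_inr]; exact extended_inr_inr
  · rcases a with a | i
    · exact extended_inl_inl.2 a.2
    · exact extended_inl_inr

theorem ncard_rootedAmo_extended_inr (K : SimpleGraph V) (m : ℕ) (i : Fin (m + 1)) :
    (rootedAmo (extended K (m + 1)) (.inr i)).ncard = (amo (extended K m)).ncard := by
  rw [show Sum.inr i = splitNew V m i none from rfl,
    ncard_eq_of_bijOn (bijOn_rootedAmo_comap (extended K (m + 1)) (splitNew V m i) none),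
    ncard_rootedAmo_none (fun a => ?_) (fun o => o.elim)]
  -- A dominating root has no far vertices, so the outer factor is one.
  · have : {δ | IsOuter ((extended K (m + 1)).comap (splitNew V m i)) δ} = {fun _ _ => False} := by
      ext δ
      refine ⟨fun _ => funext fun o => o.elim, fun _ => ⟨⟨fun o => o.elim, fun o => o.elim,
        fun o => o.elim⟩, fun _ _ o => o.elim, fun _ o => o.elim⟩⟩
    rw [this, Set.ncard_singleton, mul_one]
    congr 2
    ext a b
    rcases a with a | k <;> rcases b with b | j
    · rw [extended_inl_inl]; exact extended_inl_inl
    · exact iff_of_true extended_inl_inr extended_inl_inr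
    · exact iff_of_true extended_inr_inl extended_inr_inl
    · rw [extended_inr_inr]
      exact extended_inr_inr.trans (Fin.succAbove_right_injective.ne_iff)
  · rcases a with a | k
    · exact extended_inr_inl
    · exact extended_inr_inr.2 (Fin.succAbove_ne i k).symm

/-! ### Summation over roots and the recursion -/

theorem IsAMO.exists_root [Finite V] [Nonempty V] {G : SimpleGraph V} {r : V → V → Prop}
    (h : IsAMO G r) : ∃ v, ∀ u, ¬ r u v := by
  have : Std.Irrefl (Relation.TransGen r) := ⟨h.acyclic⟩
  obtain ⟨v, -, hv⟩ := (Finite.wellFounded_of_trans_of_irrefl (Relation.TransGen r)).has_min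
    Set.univ Set.univ_nonempty
  exact ⟨v, fun u hu => hv u trivial (.single hu)⟩

/-- An acyclic moral orientation of a graph with a dominating vertex has at most one root. -/
theorem IsAMO.root_unique {G : SimpleGraph V} {r : V → V → Prop} (h : IsAMO G r) {d : V}
    (hd : ∀ u, u ≠ d → G.Adj u d) {s t : V} (hs : ∀ u, ¬ r u s) (ht : ∀ u, ¬ r u t) : s = t := by
  by_contra hne
  have hst : ¬ G.Adj s t := fun hst => ((h.adj s t).1 hst).elim (ht s) (hs t)
  have hsd : s ≠ d := by rintro rfl; exact hst (hd t (Ne.symm hne)).symm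
  have htd : t ≠ d := by rintro rfl; exact hst (hd s hne)
  exact hst (h.moral (((h.adj s d).1 (hd s hsd)).resolve_right (hs d))
    (((h.adj t d).1 (hd t htd)).resolve_right (ht d)) hne)

/-- Finiteness gives a root and the dominating vertex makes it unique, so the rooted sets partition
the AMOs. -/
theorem ncard_amo_eq_sum [Fintype V] {G : SimpleGraph V} {d : V} (hd : ∀ u, u ≠ d → G.Adj u d) :
    (amo G).ncard = ∑ v, (rootedAmo G v).ncard := by
  have : Nonempty V := ⟨d⟩
  have hU : amo G = ⋃ v, rootedAmo G v := by
    ext r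
    rw [Set.mem_iUnion]
    exact ⟨fun h => (IsAMO.exists_root h).imp fun v hv => ⟨h, hv⟩, fun ⟨v, hv⟩ => hv.1⟩
  rw [hU, Set.ncard_iUnion_of_finite (fun v => Set.toFinite _), finsum_eq_sum_of_fintype]
  intro v w hvw
  rw [Function.onFun, Set.disjoint_left]
  exact fun r hr hr' => hvw (hr.1.root_unique hd hr.2 hr'.2)

theorem ncard_amo_extended_succ [Fintype V] (K : SimpleGraph V) (m : ℕ) :
    (amo (extended K (m + 1))).ncard = (m + 1) * (amo (extended K m)).ncard +
      ∑ v, (amo (extended (nbrGraph K v) (m + 1))).ncard *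
        {δ | IsOuter (K.comap (split K v)) δ}.ncard := by
  rw [ncard_amo_eq_sum (d := .inr 0) fun u => extended_adj_inr.2, Fintype.sum_sum_type, add_comm]
  simp [ncard_rootedAmo_extended_inl, ncard_rootedAmo_extended_inr]

theorem ncard_amo_extended_zero (K : SimpleGraph V) :
    (amo (extended K 0)).ncard = (amo K).ncard := by
  rw [ncard_eq_of_bijOn (bijOn_amo_comap (extended K 0) (Equiv.sumEmpty V (Fin 0)).symm)]
  congr 2
  ext a b
  simp

end MarkovCount

theorem theorem1 {V : Type*} [Fintype V] (K : SimpleGraph V) (hK : MarkovCount.IsChordal K) :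
    MarkovCount.f K 0 = MarkovCount.Size (MarkovCount.MixedGraph.ofUndirected K) ∧
    (∀ v : V, 0 < MarkovCount.Size
      (MarkovCount.MixedGraph.ofUndirected (MarkovCount.nbrGraph K v))) ∧
    ∀ m : ℕ, 0 < m →
      (MarkovCount.f K m : ℚ) =
        (m : ℚ) * (MarkovCount.f K (m - 1) : ℚ) +
        ∑ v : V, (MarkovCount.f (MarkovCount.nbrGraph K v) m : ℚ) *
          ((MarkovCount.RootedSize (MarkovCount.rootedEssentialGraph K v) v : ℚ) /
            (MarkovCount.Size
              (MarkovCount.MixedGraph.ofUndirected (MarkovCount.nbrGraph K v)) : ℚ)) := by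
  have hR := hK.rootable
  have hN : ∀ v, MarkovCount.Rootable (MarkovCount.nbrGraph K v) := fun v =>
    hR.comap (Function.Embedding.subtype _)
  have hpos : ∀ v : V, 0 < MarkovCount.Size
      (MarkovCount.MixedGraph.ofUndirected (MarkovCount.nbrGraph K v)) := by
    intro v
    rw [(hN v).size_eq, Set.ncard_pos]
    obtain ⟨r, hr, -⟩ := (hN v).exists_isAMO ∅ Set.subsingleton_empty
    exact ⟨r, hr⟩
  refine ⟨?_, hpos, fun m hm => ?_⟩
  · rw [MarkovCount.f, (hR.extended 0).size_eq, hR.size_eq, MarkovCount.ncard_amo_extended_zero]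
  · obtain ⟨m, rfl⟩ := Nat.exists_eq_succ_of_ne_zero hm.ne'
    rw [Nat.succ_eq_add_one, Nat.add_sub_cancel, MarkovCount.f, MarkovCount.f,
      (hR.extended _).size_eq, (hR.extended _).size_eq, MarkovCount.ncard_amo_extended_succ]
    push_cast
    congr 1
    refine Finset.sum_congr rfl fun v _ => ?_
    -- `Size(K_{N_v})` is a factor of the rooted size; cancelling it leaves the number of outer
    -- orientations.
    have h0 : ((MarkovCount.amo (MarkovCount.nbrGraph K v)).ncard : ℚ) ≠ 0 := by
      have := (hpos v).ne'
      rw [(hN v).size_eq] at this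
      exact_mod_cast this
    rw [hR.rootedSize_eq, (hN v).size_eq, MarkovCount.f, ((hN v).extended _).size_eq,
      MarkovCount.ncard_rootedAmo]
    push_cast
    rw [mul_div_cancel_left₀ _ h0]
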